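/- Let $V$ be a finite set with $n$ elements, let $G=(V,E)$ be an undirected graph without loops, and let $X_i$, $i\in V$, be jointly distributed discrete random variables with finite entropies $H(X_i)<\infty$. For $U\subseteq V$ write $X_U=(X_i)_{i\in U}$, let $G\setminus U$ be the graph obtained from $G$ by removing the vertices in $U$ and all edges meeting $U$, and let $s(U)$ be the number of connected components of $G\setminus U$. Suppose that $X_i$, $i\in V$, form the Markov graph $G$, i.e. satisfy the global Markov property: whenever $\{U,V_1,V_2\}$ is a partition of $V$ such that $V_1$ and $V_2$ are disconnected in $G\setminus U$, the variables $X_{V_1}$ and $X_{V_2}$ are independent conditioning on $X_U$. Associate to each $X_i$ a set variable $\tilde X_i$, with universal set $\Omega_V=\bigcup_{i\in V}\tilde X_i$. Write $\tilde X_U=\bigcup_{i\in U}\tilde X_i$, and let $\mathcal F_V$ be the field generated by the $\tilde X_i$. Its $2^n-1$ nonempty atoms are the sets $A=\bigcap_{i\in V}Y_i$ with each $Y_i$ equal to $\tilde X_i$ or $\tilde X_i^c$, not all of them complemented; put $U_A=\{i\in V: Y_i=\tilde X_i^c\}$. Let $\mu^*$ be the I-Measure, i.e. the unique signed measure on $\mathcal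 F_V$ with $\mu^*(\tilde X_C)=H(X_C)$, $\mu^*(\tilde X_C-\tilde X_D)=H(X_C\mid X_D)$, $\mu^*(\tilde X_C\cap\tilde X_D)=I(X_C;X_D)$ and $\mu^*(\tilde X_C\cap\tilde X_D-\tilde X_K)=I(X_C;X_D\mid X_K)$ for all $C,D,K\subseteq V$. Let $A$ be a Type I atom of $G$, i.e. a nonempty atom with $s(U_A)=1$, and suppose that $|U_A|\le n-2$. Let $$B=\{k\in V\setminus U_A : s(U_A\cup\{k\})=1\}.$$ Then $$\mu^*(A)=\mu^*\Bigl(\bigcap_{k\in B}\tilde X_k-\tilde X_{U_A}\Bigr),$$ and $|B|\ge 2$. -/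

import Mathlib

open MeasureTheory

/-! ### Discrete random variables, entropy and conditional independence -/

section Probability

variable {Ω : Type*} [MeasurableSpace Ω]

/-- Shannon entropy `H(Y) = -∑ y, P(Y = y) log P(Y = y)` (natural logarithm) of a discrete random
variable `Y`, as an element of `[0, ∞]`. -/
noncomputable def shannonEntropy (P : Measure Ω) {T : Type*} (Y : Ω → T) : ENNReal :=
  ∑' y : T, ENNReal.ofReal (Real.negMulLog (P.real (Y ⁻¹' {y})))

/-- `Y` and `Z` are independent conditioning on `T`, for discrete random variables:
`P(Y = y, Z = z, T = t) P(T = t) = P(Y = y, T = t) P(Z = z, T = t)` for all `y, z, t`. -/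
def DiscreteCondIndep (P : Measure Ω) {α β γ : Type*} (Y : Ω → α) (Z : Ω → β) (T : Ω → γ) : Prop :=
  ∀ (y : α) (z : β) (t : γ),
    P.real (Y ⁻¹' {y} ∩ Z ⁻¹' {z} ∩ T ⁻¹' {t}) * P.real (T ⁻¹' {t}) =
      P.real (Y ⁻¹' {y} ∩ T ⁻¹' {t}) * P.real (Z ⁻¹' {z} ∩ T ⁻¹' {t})

variable {V : Type*} {S : V → Type*}

/-- The joint random variable `X_U = (X_i, i ∈ U)`. -/
def jointVar (X : ∀ i, Ω → S i) (U : Finset V) (ω : Ω) : ∀ i : U, S i := fun i => X i ω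

/-- The joint entropy `H(X_U)`, as a real number. -/
noncomputable def jointEntropy (P : Measure Ω) (X : ∀ i, Ω → S i) (U : Finset V) : ℝ :=
  (shannonEntropy P (jointVar X U)).toReal

theorem jointEntropy_empty (P : Measure Ω) [IsProbabilityMeasure P] (X : ∀ i, Ω → S i) :
    jointEntropy P X ∅ = 0 := by
  have : ∀ y, jointVar X ∅ ⁻¹' {y} = Set.univ := fun y =>
    Set.eq_univ_of_forall fun ω => funext fun i => absurd i.2 (Finset.notMem_empty _)
  simp [jointEntropy, shannonEntropy, this]

variable [DecidableEq V]

/-- `H(X_C | X_D) = H(X_C, X_D) - H(X_D)`. -/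
noncomputable def condEntropy (P : Measure Ω) (X : ∀ i, Ω → S i) (C D : Finset V) : ℝ :=
  jointEntropy P X (C ∪ D) - jointEntropy P X D

/-- `I(X_C ; X_D) = H(X_C) - H(X_C | X_D)`. -/
noncomputable def mutualInfo (P : Measure Ω) (X : ∀ i, Ω → S i) (C D : Finset V) : ℝ :=
  jointEntropy P X C - condEntropy P X C D

/-- `I(X_C ; X_D | X_K) = H(X_C | X_K) - H(X_C | X_D, X_K)`. -/
noncomputable def condMutualInfo (P : Measure Ω) (X : ∀ i, Ω → S i) (C D K : Finset V) : ℝ :=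
  condEntropy P X C K - condEntropy P X C (D ∪ K)

end Probability

/-! ### Set variables, the field they generate, and its atoms -/

section SetVariables

/-- The universal set `Ω_V = ⋃ i, X̃_i`. There is one point for each nonempty set of indices `W`,
namely the point that lies in `X̃_i` exactly for `i ∈ W`. -/
@[ext]
structure InfoSpace (V : Type*) where
  /-- the set of all `i` such that the point lies in `X̃_i` -/
  idx : Finset V
  idx_nonempty : idx.Nonempty

variable {V : Type*}

/-- The set variable `X̃_i`. -/
def setVar (i : V) : Set (InfoSpace V) := {W | i ∈ W.idx}

/-- `X̃_U = ⋃ i ∈ U, X̃_i`. -/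
def setVarUnion (U : Finset V) : Set (InfoSpace V) := ⋃ i ∈ U, setVar i

theorem mem_setVarUnion (U : Finset V) (W : InfoSpace V) :
    W ∈ setVarUnion U ↔ ∃ i ∈ U, i ∈ W.idx := by
  simp [setVarUnion, setVar]

/-- The field `F_V` generated by the set variables `X̃_i`. -/
instance InfoSpace.instMeasurableSpace : MeasurableSpace (InfoSpace V) :=
  MeasurableSpace.generateFrom (Set.range (setVar (V := V)))

/-- `A` is a (nonempty) atom of `F_V`: `A = ⋂ i, Y_i` where each `Y_i` is `X̃_i` or its
complement. -/
def IsInfoAtom (A : Set (InfoSpace V)) : Prop :=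
  A.Nonempty ∧ ∃ Y : V → Set (InfoSpace V),
    (∀ i, Y i = setVar i ∨ Y i = (setVar i)ᶜ) ∧ A = ⋂ i, Y i

open Classical in
/-- For a nonempty atom `A = ⋂ i, Y_i`, the set `U_A = {i | Y_i = X̃_iᶜ}`; see
`mem_complementedIndices`. -/
noncomputable def complementedIndices [Fintype V] (A : Set (InfoSpace V)) : Finset V :=
  {i | A ⊆ (setVar i)ᶜ}

theorem mem_complementedIndices [Fintype V] {Y : V → Set (InfoSpace V)}
    (hY : ∀ i, Y i = setVar i ∨ Y i = (setVar i)ᶜ) (hne : (⋂ i, Y i).Nonempty) (i : V) :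
    i ∈ complementedIndices (⋂ i, Y i) ↔ Y i = (setVar i)ᶜ := by
  obtain ⟨w, hw⟩ := hne
  have hwi : w ∈ Y i := Set.mem_iInter.1 hw i
  simp only [complementedIndices, Finset.mem_filter, Finset.mem_univ, true_and]
  constructor
  · intro h
    rcases hY i with h1 | h1
    · exact absurd (h1 ▸ hwi) (h hw)
    · exact h1
  · intro h
    rw [← h]
    exact Set.iInter_subset _ i

end SetVariables

/-! ### The I-Measure -/

section IMeasure

variable {Ω : Type*} [MeasurableSpace Ω] {V : Type*} [DecidableEq V] {S : V → Type*}

/-- The signed measure `ν` on `F_V` is consistent with all of Shannon's information measures of the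
`X_i` under the substitution `H/I ↦ ν`, `, ↦ ∪`, `; ↦ ∩`, `| ↦ -`. -/
structure IsIMeasure (P : Measure Ω) (X : ∀ i, Ω → S i) (ν : SignedMeasure (InfoSpace V)) :
    Prop where
  entropy : ∀ C : Finset V, ν (setVarUnion C) = jointEntropy P X C
  cond_entropy : ∀ C D : Finset V, ν (setVarUnion C \ setVarUnion D) = condEntropy P X C D
  mutual_info : ∀ C D : Finset V, ν (setVarUnion C ∩ setVarUnion D) = mutualInfo P X C D
  cond_mutual_info : ∀ C D K : Finset V,
    ν ((setVarUnion C ∩ setVarUnion D) \ setVarUnion K) = condMutualInfo P X C D K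

end IMeasure

section IMeasureExistence

variable {V : Type*} [Fintype V] [DecidableEq V]

noncomputable instance InfoSpace.instFintype : Fintype (InfoSpace V) :=
  Fintype.ofInjective InfoSpace.idx fun _ _ h => InfoSpace.ext h

theorem InfoSpace.measurableSet (A : Set (InfoSpace V)) : MeasurableSet A := by
  have hs : ∀ i : V, MeasurableSet (setVar i) := fun i =>
    MeasurableSpace.measurableSet_generateFrom ⟨i, rfl⟩
  have h1 : ∀ W : InfoSpace V, MeasurableSet ({W} : Set (InfoSpace V)) := by
    intro W
    have : ({W} : Set (InfoSpace V)) =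
        ⋂ i, (if i ∈ W.idx then setVar i else (setVar i)ᶜ) := by
      ext Z
      simp only [Set.mem_singleton_iff, Set.mem_iInter]
      constructor
      · rintro rfl i
        split_ifs with h <;> simpa [setVar] using h
      · intro h
        apply InfoSpace.ext
        ext i
        have := h i
        split_ifs at this with h2
        · exact ⟨fun _ => h2, fun _ => this⟩
        · exact ⟨fun h3 => absurd h3 this, fun h3 => absurd h3 h2⟩
    rw [this]
    refine MeasurableSet.iInter fun i => ?_
    split_ifs
    · exact hs i
    · exact (hs i).compl
  exact (Set.toFinite A).induction_on A .empty (fun {a s} _ _ h => (h1 a).union h)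

theorem InfoSpace.signedMeasure_eq_sum (ν : SignedMeasure (InfoSpace V))
    (A : Set (InfoSpace V)) [DecidablePred (· ∈ A)] :
    ν A = ∑ W : InfoSpace V, if W ∈ A then ν {W} else 0 := by
  classical
  have key : ∀ F : Finset (InfoSpace V), ν (F : Set (InfoSpace V)) = ∑ W ∈ F, ν {W} := by
    intro F
    induction F using Finset.induction_on with
    | empty => simp
    | insert a F ha ih =>
      rw [Finset.coe_insert, Set.insert_eq, VectorMeasure.of_union _ (InfoSpace.measurableSet _)
        (InfoSpace.measurableSet _), ih, Finset.sum_insert ha]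
      simpa using ha
  rw [← Finset.sum_filter, ← key]
  congr 1
  ext W
  simp

/-- A function on `InfoSpace V` whose sums over all the sets `X̃_U` vanish is zero. -/
theorem InfoSpace.eq_zero_of_sum_eq_zero (d : InfoSpace V → ℝ)
    (h : ∀ U : Finset V, ∑ W : InfoSpace V, (if ∃ i ∈ U, i ∈ W.idx then d W else 0) = 0) :
    d = 0 := by
  have h2 : ∀ T : Finset V, ∑ W : InfoSpace V, (if W.idx ⊆ T then d W else 0) = 0 := by
    intro T
    have e : ∀ W : InfoSpace V, (if W.idx ⊆ T then d W else 0) =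
        (if ∃ i ∈ Finset.univ, i ∈ W.idx then d W else 0) -
          (if ∃ i ∈ Tᶜ, i ∈ W.idx then d W else 0) := by
      intro W
      have h1 : ∃ i ∈ Finset.univ, i ∈ W.idx := by
        obtain ⟨i, hi⟩ := W.idx_nonempty
        exact ⟨i, Finset.mem_univ _, hi⟩
      rw [if_pos h1]
      by_cases hW : W.idx ⊆ T
      · rw [if_pos hW, if_neg]
        · simp
        · rintro ⟨i, hi, hiW⟩
          exact (Finset.mem_compl.1 hi) (hW hiW)
      · rw [if_neg hW, if_pos]
        · simp
        · obtain ⟨i, hiW, hi⟩ := Finset.not_subset.1 hW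
          exact ⟨i, Finset.mem_compl.2 hi, hiW⟩
    have hu : ∑ W : InfoSpace V,
        (if ∃ i ∈ (Finset.univ : Finset V), i ∈ W.idx then d W else 0) = 0 := by
      convert h Finset.univ
    rw [Finset.sum_congr rfl fun W _ => e W, Finset.sum_sub_distrib, h, sub_zero]
    convert hu
  have h3 : ∀ (n : ℕ) (T : InfoSpace V), T.idx.card = n → d T = 0 := by
    intro n
    induction n using Nat.strong_induction_on with
    | _ n ih =>
      intro T hT
      have := h2 T.idx
      rw [Finset.sum_eq_single T] at this
      · simpa using this
      · intro W _ hne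
        split_ifs with hW
        · refine ih W.idx.card ?_ W rfl
          rw [← hT]
          exact Finset.card_lt_card (lt_of_le_of_ne hW fun h => hne (InfoSpace.ext h))
        · rfl
      · intro hn
        exact absurd (Finset.mem_univ _) hn
  funext T
  exact h3 _ T rfl

variable {Ω : Type*} [MeasurableSpace Ω] {S : V → Type*}

/-- A signed measure that gives the joint entropies gives all of Shannon's information measures. -/
theorem IsIMeasure.of_entropy (P : Measure Ω) (X : ∀ i, Ω → S i)
    (ν : SignedMeasure (InfoSpace V))
    (h : ∀ C : Finset V, ν (setVarUnion C) = jointEntropy P X C)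
    (h0 : jointEntropy P X ∅ = 0) : IsIMeasure P X ν := by
  have hU : ∀ C D : Finset V, (setVarUnion (C ∪ D) : Set (InfoSpace V)) =
      setVarUnion C ∪ setVarUnion D := by
    intro C D
    exact Finset.set_biUnion_union C D _
  have hc : ∀ C D : Finset V, ν (setVarUnion C \ setVarUnion D) = condEntropy P X C D := by
    intro C D
    have h1 : ν (setVarUnion (C ∪ D)) =
        ν (setVarUnion D) + ν (setVarUnion C \ setVarUnion D) := by
      rw [← VectorMeasure.of_union Set.disjoint_sdiff_right (InfoSpace.measurableSet _)
        (InfoSpace.measurableSet _), Set.union_sdiff_self, hU, Set.union_comm]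
    rw [condEntropy, ← h, ← h, h1]
    ring
  have hm : ∀ C D K : Finset V,
      ν ((setVarUnion C ∩ setVarUnion D) \ setVarUnion K) = condMutualInfo P X C D K := by
    intro C D K
    have h1 : ν (setVarUnion C \ setVarUnion K) =
        ν ((setVarUnion C ∩ setVarUnion D) \ setVarUnion K) +
          ν (setVarUnion C \ setVarUnion (D ∪ K)) := by
      rw [← VectorMeasure.of_union ?_ (InfoSpace.measurableSet _) (InfoSpace.measurableSet _)]
      · congr 1
        ext W
        simp only [hU, Set.mem_union, Set.mem_sdiff, Set.mem_inter_iff]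
        tauto
      · rw [Set.disjoint_left]
        simp only [hU, Set.mem_union, Set.mem_sdiff, Set.mem_inter_iff]
        tauto
    rw [condMutualInfo, ← hc, ← hc, h1]
    ring
  refine ⟨h, hc, fun C D => ?_, hm⟩
  have h1 := hm C D ∅
  have h2 : (setVarUnion ∅ : Set (InfoSpace V)) = ∅ := by simp [setVarUnion]
  rw [h2, Set.sdiff_empty] at h1
  rw [h1, condMutualInfo, mutualInfo, condEntropy, h0, Finset.union_empty, Finset.union_empty,
    sub_zero]

/-- There is exactly one signed measure on `F_V` that is consistent with all of Shannon's
information measures. -/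
theorem existsUnique_isIMeasure (P : Measure Ω) [IsProbabilityMeasure P] (X : ∀ i, Ω → S i) :
    ∃! ν : SignedMeasure (InfoSpace V), IsIMeasure P X ν := by
  classical
  let L : (InfoSpace V → ℝ) →ₗ[ℝ] (InfoSpace V → ℝ) :=
    { toFun := fun f U => ∑ W : InfoSpace V, if ∃ i ∈ U.idx, i ∈ W.idx then f W else 0
      map_add' := by
        intro f g
        funext U
        simp only [Pi.add_apply, ← Finset.sum_add_distrib]
        refine Finset.sum_congr rfl fun W _ => ?_
        split_ifs <;> simp
      map_smul' := by
        intro c f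
        funext U
        simp [Finset.mul_sum] }
  have hLinj : Function.Injective L := by
    rw [injective_iff_map_eq_zero]
    intro d hd
    refine InfoSpace.eq_zero_of_sum_eq_zero d fun U => ?_
    rcases U.eq_empty_or_nonempty with rfl | hU
    · simp
    · exact congrFun hd ⟨U, hU⟩
  obtain ⟨f, hf⟩ := LinearMap.injective_iff_surjective.1 hLinj
    (fun U => jointEntropy P X U.idx)
  let ν : SignedMeasure (InfoSpace V) := ∑ W, f W • (Measure.dirac W).toSignedMeasure
  have hν : ∀ C : Finset V, ν (setVarUnion C) = jointEntropy P X C := by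
    intro C
    have e : ν (setVarUnion C) =
        ∑ W : InfoSpace V, if ∃ i ∈ C, i ∈ W.idx then f W else 0 := by
      simp only [ν, FunLike.coe_sum, Finset.sum_apply, FunLike.coe_smul,
        Pi.smul_apply, smul_eq_mul]
      refine Finset.sum_congr rfl fun W _ => ?_
      rw [Measure.toSignedMeasure_apply_measurable (InfoSpace.measurableSet _), Measure.real,
        Measure.dirac_apply' _ (InfoSpace.measurableSet _), Set.indicator_apply]
      simp only [mem_setVarUnion]
      split_ifs <;> simp
    rw [e]
    rcases C.eq_empty_or_nonempty with rfl | hC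
    · simp [jointEntropy_empty]
    · exact congrFun hf ⟨C, hC⟩
  refine ⟨ν, IsIMeasure.of_entropy P X ν hν (jointEntropy_empty P X), fun ν' h' => ?_⟩
  have hd : (fun W : InfoSpace V => ν' {W} - ν {W}) = 0 := by
    refine InfoSpace.eq_zero_of_sum_eq_zero _ fun U => ?_
    have h1 := (h'.entropy U).trans (hν U).symm
    rw [InfoSpace.signedMeasure_eq_sum ν', InfoSpace.signedMeasure_eq_sum ν, ← sub_eq_zero,
      ← Finset.sum_sub_distrib] at h1
    refine Eq.trans (Finset.sum_congr rfl fun W _ => ?_) h1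
    simp only [mem_setVarUnion]
    split_ifs <;> simp
  ext A _
  rw [InfoSpace.signedMeasure_eq_sum ν', InfoSpace.signedMeasure_eq_sum ν]
  refine Finset.sum_congr rfl fun W _ => ?_
  rw [sub_eq_zero.1 (congrFun hd W)]

/-- The I-Measure `μ*`: the unique signed measure on `F_V` that is consistent with all of Shannon's
information measures. -/
noncomputable def iMeasure (P : Measure Ω) [IsProbabilityMeasure P] (X : ∀ i, Ω → S i) :
    SignedMeasure (InfoSpace V) :=
  (existsUnique_isIMeasure P X).choose

theorem iMeasure_spec (P : Measure Ω) [IsProbabilityMeasure P] (X : ∀ i, Ω → S i) :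
    IsIMeasure P X (iMeasure P X) :=
  (existsUnique_isIMeasure P X).choose_spec.1

end IMeasureExistence

/-! ### Graphs and Markov random fields -/

section Graph

variable {V : Type*}

/-- `G \ U`: the graph obtained by removing the vertices in `U`. -/
def removeVertices (G : SimpleGraph V) (U : Finset V) : SimpleGraph {v : V | v ∉ U} :=
  G.induce {v | v ∉ U}

/-- `s(U)`: the number of components of `G \ U`. -/
noncomputable def numComponents (G : SimpleGraph V) (U : Finset V) : ℕ :=
  Nat.card (removeVertices G U).ConnectedComponent

/-- `A` is a Type I atom of `G`: an atom of `F_V` with `s(U_A) = 1`. -/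
def IsTypeIAtom [Fintype V] (G : SimpleGraph V) (A : Set (InfoSpace V)) : Prop :=
  IsInfoAtom A ∧ numComponents G (complementedIndices A) = 1

/-- `{k ∈ V - U | s(U ∪ {k}) = 1}`. -/
noncomputable def nonCutVertices [Fintype V] [DecidableEq V] (G : SimpleGraph V) (U : Finset V) :
    Finset V :=
  {k | k ∉ U ∧ numComponents G (U ∪ {k}) = 1}

/-- The `X_i` form a Markov graph `G` (global Markov property): for each partition `{U, V₁, V₂}` of
the vertices such that `V₁` and `V₂` are disconnected in `G \ U`, the joint variables `X_{V₁}` and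
`X_{V₂}` are independent conditioning on `X_U`. -/
def FormMarkovGraph [Fintype V] [DecidableEq V] {Ω : Type*} [MeasurableSpace Ω] {S : V → Type*}
    (P : Measure Ω) (X : ∀ i, Ω → S i) (G : SimpleGraph V) : Prop :=
  ∀ U V₁ V₂ : Finset V, Disjoint U V₁ → Disjoint U V₂ → Disjoint V₁ V₂ →
    U ∪ V₁ ∪ V₂ = Finset.univ →
    (∀ a b : {v : V | v ∉ U}, a.1 ∈ V₁ → b.1 ∈ V₂ → ¬ (removeVertices G U).Reachable a b) →
    DiscreteCondIndep P (jointVar X V₁) (jointVar X V₂) (jointVar X U)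

end Graph

/-! ### Entropies of discrete random variables as integrals -/

section Entropy

variable {Ω : Type*} [MeasurableSpace Ω] {P : Measure Ω}

/-! Write `U` for `U_A`. The set on the right splits into atoms, each given by the set `W` of
indices at which it is not complemented, with `B ⊆ W ⊆ V \ U`. The atom `A` is the one with `W = V \
U`, and all the others have measure zero, for two reasons.

Markov property: `μ*` vanishes on an atom whose `W` is not connected in `G`. Split `W` into one
component `V₁` and the rest `V₂`, and let `K` be the complement of `W`. Then `X_C` and `X_D` are
independent given `X_K` for all `C ⊆ V₁`, `D ⊆ V₂`, so `I(X_C; X_D | X_K) = 0`, and inverting these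
linear relations (`IsIMeasure.singleton_eq_zero`) kills each atom that meets both parts and avoids
`K`. Passing from independence to zero information needs finite joint entropies
(`shannonEntropy_lt_top_of_pair`).

Connectivity: let `W` be a connected proper subset of the connected set `V \ U`. Adding adjacent
vertices one at a time, the last one added lies outside `W` and is not a cut vertex
(`exists_connected_induce_diff_singleton`), so `W` does not contain `B`. Starting instead from a
single vertex, the same argument yields `|B| ≥ 2`. -/

/-- The values of probability zero are countably many, hence jointly null. This allows logarithms of
products to be split almost everywhere, despite `Real.log 0 = 0`. -/
theorem ae_measureReal_preimage_pos [IsFiniteMeasure P] {T : Type*} [Countable T]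
    [MeasurableSpace T] [MeasurableSingletonClass T] {Y : Ω → T} (hY : Measurable Y) :
    ∀ᵐ ω ∂P, 0 < P.real (Y ⁻¹' {Y ω}) := by
  refine ae_of_ae_map (p := fun y => 0 < P.real (Y ⁻¹' {y})) hY.aemeasurable ?_
  rw [ae_iff_of_countable]
  intro y hy
  rw [Measure.map_apply hY (measurableSet_singleton y)] at hy
  exact ENNReal.toReal_pos hy (measure_ne_top _ _)

theorem measurable_neg_log_measureReal_preimage {T : Type*} [Countable T]
    [MeasurableSpace T] [MeasurableSingletonClass T] {Y : Ω → T} (hY : Measurable Y) :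
    Measurable fun ω => ENNReal.ofReal (-Real.log (P.real (Y ⁻¹' {Y ω}))) :=
  (Measurable.of_discrete (f := fun y => ENNReal.ofReal (-Real.log (P.real (Y ⁻¹' {y}))))).comp hY

theorem neg_log_measureReal_nonneg [IsProbabilityMeasure P] (s : Set Ω) :
    0 ≤ -Real.log (P.real s) :=
  neg_nonneg.2 (Real.log_nonpos measureReal_nonneg measureReal_le_one)

/-- The entropy of `Y` is the expectation of `-log P(Y = y)`. -/
theorem shannonEntropy_eq_lintegral [IsProbabilityMeasure P] {T : Type*} [Countable T]
    [MeasurableSpace T] [MeasurableSingletonClass T] {Y : Ω → T} (hY : Measurable Y) :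
    shannonEntropy P Y = ∫⁻ ω, ENNReal.ofReal (-Real.log (P.real (Y ⁻¹' {Y ω}))) ∂P := by
  rw [← lintegral_map (f := fun y => ENNReal.ofReal (-Real.log (P.real (Y ⁻¹' {y}))))
    Measurable.of_discrete hY, lintegral_countable', shannonEntropy]
  refine tsum_congr fun y => ?_
  rw [Measure.map_apply hY (measurableSet_singleton y), ← ofReal_measureReal,
    ← ENNReal.ofReal_mul (neg_log_measureReal_nonneg _), Real.negMulLog]
  congr 1
  ring

theorem tsum_measure_preimage_singleton [IsProbabilityMeasure P] {T : Type*} [Countable T]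
    [MeasurableSpace T] [MeasurableSingletonClass T] {Y : Ω → T} (hY : Measurable Y) :
    ∑' y, P (Y ⁻¹' {y}) = 1 := by
  have h := lintegral_countable' (μ := P.map Y) (fun _ => 1)
  rw [lintegral_one, Measure.map_apply hY .univ, Set.preimage_univ, measure_univ] at h
  rw [h]
  exact tsum_congr fun y => by rw [Measure.map_apply hY (measurableSet_singleton y), one_mul]

/-- Finiteness of the entropies of `Y` and `Z` passes to any `W` whose level sets are those of
the pair `(Y, Z)`. -/
theorem shannonEntropy_lt_top_of_pair [IsProbabilityMeasure P] {α β γ : Type*}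
    [Countable α] [MeasurableSpace α] [MeasurableSingletonClass α]
    [Countable β] [MeasurableSpace β] [MeasurableSingletonClass β]
    [Countable γ] [MeasurableSpace γ] [MeasurableSingletonClass γ]
    {Y : Ω → α} {Z : Ω → β} {W : Ω → γ}
    (hY : Measurable Y) (hZ : Measurable Z) (hW : Measurable W)
    (hYZ : ∀ ω, W ⁻¹' {W ω} = Y ⁻¹' {Y ω} ∩ Z ⁻¹' {Z ω})
    (hHY : shannonEntropy P Y < ⊤) (hHZ : shannonEntropy P Z < ⊤) :
    shannonEntropy P W < ⊤ := by
  let p : α × β → ℝ := fun x => P.real (Y ⁻¹' {x.1} ∩ Z ⁻¹' {x.2})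
  let q : α × β → ℝ := fun x => P.real (Y ⁻¹' {x.1}) * P.real (Z ⁻¹' {x.2})
  have hpair : Measurable fun ω => (Y ω, Z ω) := hY.prodMk hZ
  -- The expectation of `q / p` is the sum of `q` over the support of `p`, and `q` has total mass 1.
  have hratio : ∫⁻ ω, ENNReal.ofReal (q (Y ω, Z ω) / p (Y ω, Z ω)) ∂P ≤ 1 := by
    rw [← lintegral_map (f := fun x => ENNReal.ofReal (q x / p x)) Measurable.of_discrete hpair,
      lintegral_countable']
    have hle : ∀ x : α × β, ENNReal.ofReal (q x / p x) * (P.map fun ω => (Y ω, Z ω)) {x} ≤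
        P (Y ⁻¹' {x.1}) * P (Z ⁻¹' {x.2}) := by
      intro x
      have hpre : (fun ω => (Y ω, Z ω)) ⁻¹' {x} = Y ⁻¹' {x.1} ∩ Z ⁻¹' {x.2} := by
        ext ω
        simp [Prod.ext_iff]
      have hq : 0 ≤ q x := mul_nonneg measureReal_nonneg measureReal_nonneg
      have hp : 0 ≤ p x := measureReal_nonneg
      rw [Measure.map_apply hpair (measurableSet_singleton x), hpre, ← ofReal_measureReal,
        ← ENNReal.ofReal_mul (div_nonneg hq hp), ← ofReal_measureReal, ← ofReal_measureReal,
        ← ENNReal.ofReal_mul measureReal_nonneg]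
      refine ENNReal.ofReal_le_ofReal ?_
      change q x / p x * p x ≤ q x
      rcases hp.eq_or_lt with h0 | h0
      · exact (mul_eq_zero_of_right _ h0.symm).trans_le hq
      · exact (div_mul_cancel₀ _ h0.ne').le
    refine (ENNReal.tsum_le_tsum hle).trans ?_
    rw [ENNReal.tsum_prod']
    simp only [ENNReal.tsum_mul_left, tsum_measure_preimage_singleton hZ, mul_one,
      tsum_measure_preimage_singleton hY, le_refl]
  -- Pointwise, `-log p = -log q + log (q / p) ≤ -log q + q / p`. The weak bound `log x ≤ x` keeps
  -- every term nonnegative, so the integrals can stay in `[0, ∞]`.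
  have hbound : shannonEntropy P W ≤ shannonEntropy P Y + shannonEntropy P Z + 1 := by
    refine le_trans ?_ (add_le_add_right hratio _)
    rw [shannonEntropy_eq_lintegral hW, shannonEntropy_eq_lintegral hY,
      shannonEntropy_eq_lintegral hZ,
      ← lintegral_add_left (measurable_neg_log_measureReal_preimage hY),
      ← lintegral_add_left (f := fun ω => _ + _) ((measurable_neg_log_measureReal_preimage hY).add
        (measurable_neg_log_measureReal_preimage hZ))]
    refine lintegral_mono_ae ?_
    filter_upwards [ae_measureReal_preimage_pos hY, ae_measureReal_preimage_pos hZ,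
      ae_measureReal_preimage_pos hW] with ω h1 h2 h3
    rw [hYZ] at h3 ⊢
    rw [← ENNReal.ofReal_add (neg_log_measureReal_nonneg _) (neg_log_measureReal_nonneg _),
      ← ENNReal.ofReal_add (add_nonneg (neg_log_measureReal_nonneg _)
        (neg_log_measureReal_nonneg _)) (by positivity)]
    refine ENNReal.ofReal_le_ofReal ?_
    have h4 := Real.log_le_self (x := q (Y ω, Z ω) / p (Y ω, Z ω)) (by positivity)
    rw [Real.log_div (mul_pos h1 h2).ne' h3.ne', Real.log_mul h1.ne' h2.ne'] at h4
    simp only [p, q] at h4 ⊢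
    linarith
  exact hbound.trans_lt (by simp [hHY, hHZ])

end Entropy

/-! ### Conditional independence -/

section CondIndep

variable {Ω : Type*} [MeasurableSpace Ω] {P : Measure Ω} {α α' β β' γ : Type*}
  {Y : Ω → α} {Z : Ω → β} {T : Ω → γ}

theorem DiscreteCondIndep.symm (h : DiscreteCondIndep P Y Z T) : DiscreteCondIndep P Z Y T := by
  intro z y t
  rw [Set.inter_comm (Z ⁻¹' {z}), h y z t, mul_comm]

theorem DiscreteCondIndep.comp_left [IsFiniteMeasure P] [Countable α] [MeasurableSpace α]
    [MeasurableSingletonClass α] (hY : Measurable Y) (h : DiscreteCondIndep P Y Z T)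
    (f : α → α') : DiscreteCondIndep P (f ∘ Y) Z T := by
  intro y' z t
  -- For fixed `z` and `t`, the hypothesis says that two finite measures on the countable type `α`
  -- agree on singletons. They are therefore equal, and can be evaluated on a fibre of `f`.
  have key : (P (T ⁻¹' {t})) • (P.restrict (Z ⁻¹' {z} ∩ T ⁻¹' {t})).map Y =
      (P (Z ⁻¹' {z} ∩ T ⁻¹' {t})) • (P.restrict (T ⁻¹' {t})).map Y := by
    refine Measure.ext_of_singleton fun y => ?_
    have hm := hY (measurableSet_singleton y)
    rw [Measure.smul_apply, Measure.smul_apply, Measure.map_apply hY (measurableSet_singleton y),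
      Measure.map_apply hY (measurableSet_singleton y), Measure.restrict_apply hm,
      Measure.restrict_apply hm, smul_eq_mul, smul_eq_mul, ← Set.inter_assoc,
      ← ENNReal.toReal_eq_toReal_iff' (by finiteness) (by finiteness), ENNReal.toReal_mul,
      ENNReal.toReal_mul]
    have := h y z t
    simp only [measureReal_def] at this
    rw [mul_comm, this, mul_comm]
  have hs : MeasurableSet (f ⁻¹' {y'}) := MeasurableSet.of_discrete
  have := congrArg (fun μ => (μ (f ⁻¹' {y'})).toReal) key
  simp only [Measure.smul_apply, Measure.map_apply hY hs, Measure.restrict_apply (hY hs),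
    smul_eq_mul, ENNReal.toReal_mul, ← Set.inter_assoc] at this
  simp only [measureReal_def, Set.preimage_comp]
  rw [mul_comm, this, mul_comm]

/-- For `Y` and `Z` independent conditioning on `T`, `H(Y, Z, T) + H(T) = H(Y, T) + H(Z, T)`. -/
theorem DiscreteCondIndep.shannonEntropy_add [IsProbabilityMeasure P] {δ δ₁ δ₂ : Type*}
    [Countable γ] [MeasurableSpace γ] [MeasurableSingletonClass γ]
    [Countable δ] [MeasurableSpace δ] [MeasurableSingletonClass δ]
    [Countable δ₁] [MeasurableSpace δ₁] [MeasurableSingletonClass δ₁]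
    [Countable δ₂] [MeasurableSpace δ₂] [MeasurableSingletonClass δ₂]
    (h : DiscreteCondIndep P Y Z T) (hT : Measurable T) {W : Ω → δ} (hW : Measurable W)
    {W₁ : Ω → δ₁} (hW₁ : Measurable W₁) {W₂ : Ω → δ₂} (hW₂ : Measurable W₂)
    (e : ∀ ω, W ⁻¹' {W ω} = Y ⁻¹' {Y ω} ∩ Z ⁻¹' {Z ω} ∩ T ⁻¹' {T ω})
    (e₁ : ∀ ω, W₁ ⁻¹' {W₁ ω} = Y ⁻¹' {Y ω} ∩ T ⁻¹' {T ω})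
    (e₂ : ∀ ω, W₂ ⁻¹' {W₂ ω} = Z ⁻¹' {Z ω} ∩ T ⁻¹' {T ω}) :
    shannonEntropy P W + shannonEntropy P T = shannonEntropy P W₁ + shannonEntropy P W₂ := by
  rw [shannonEntropy_eq_lintegral hW, shannonEntropy_eq_lintegral hT,
    shannonEntropy_eq_lintegral hW₁, shannonEntropy_eq_lintegral hW₂,
    ← lintegral_add_left (measurable_neg_log_measureReal_preimage hW),
    ← lintegral_add_left (measurable_neg_log_measureReal_preimage hW₁)]
  -- The integrands already agree almost everywhere: independence equates two products of
  -- probabilities, and the logarithm turns these into sums.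
  refine lintegral_congr_ae ?_
  filter_upwards [ae_measureReal_preimage_pos hW, ae_measureReal_preimage_pos hT,
    ae_measureReal_preimage_pos hW₁, ae_measureReal_preimage_pos hW₂] with ω h1 h2 h3 h4
  rw [← ENNReal.ofReal_add (neg_log_measureReal_nonneg _) (neg_log_measureReal_nonneg _),
    ← ENNReal.ofReal_add (neg_log_measureReal_nonneg _) (neg_log_measureReal_nonneg _),
    ← neg_add, ← neg_add, ← Real.log_mul h1.ne' h2.ne', ← Real.log_mul h3.ne' h4.ne',
    e, e₁, e₂, h]

end CondIndep

/-! ### Joint variables -/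

section JointVar

variable {Ω V : Type*} {S : V → Type*}

theorem jointVar_preimage_singleton_apply (X : ∀ i, Ω → S i) (U : Finset V) (ω : Ω) :
    jointVar X U ⁻¹' {jointVar X U ω} = {ω' | ∀ i ∈ U, X i ω' = X i ω} := by
  ext ω'
  simp [jointVar, funext_iff]

theorem jointVar_preimage_singleton_union [DecidableEq V] (X : ∀ i, Ω → S i) (C D : Finset V)
    (ω : Ω) :
    jointVar X (C ∪ D) ⁻¹' {jointVar X (C ∪ D) ω} =
      jointVar X C ⁻¹' {jointVar X C ω} ∩ jointVar X D ⁻¹' {jointVar X D ω} := by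
  simp only [jointVar_preimage_singleton_apply]
  ext ω'
  simp only [Finset.mem_union, Set.mem_ofPred_eq, Set.mem_inter_iff]
  grind

variable [MeasurableSpace Ω] {P : Measure Ω}

theorem measurable_jointVar [∀ i, MeasurableSpace (S i)] {X : ∀ i, Ω → S i}
    (hX : ∀ i, Measurable (X i)) (U : Finset V) : Measurable (jointVar X U) :=
  measurable_pi_lambda _ fun i => hX i

theorem DiscreteCondIndep.jointVar_subset [IsFiniteMeasure P] [∀ i, Countable (S i)]
    [∀ i, MeasurableSpace (S i)] [∀ i, MeasurableSingletonClass (S i)] {X : ∀ i, Ω → S i}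
    (hX : ∀ i, Measurable (X i)) {C C' D D' K : Finset V} (hC : C' ⊆ C) (hD : D' ⊆ D)
    (h : DiscreteCondIndep P (jointVar X C) (jointVar X D) (jointVar X K)) :
    DiscreteCondIndep P (jointVar X C') (jointVar X D') (jointVar X K) := by
  have h1 := h.comp_left (measurable_jointVar hX C)
    (fun x (i : C') => x ⟨i, hC i.2⟩)
  exact (h1.symm.comp_left (measurable_jointVar hX D) (fun x (i : D') => x ⟨i, hD i.2⟩)).symm

variable [DecidableEq V] [IsProbabilityMeasure P] [∀ i, Countable (S i)]
  [∀ i, MeasurableSpace (S i)] [∀ i, MeasurableSingletonClass (S i)] {X : ∀ i, Ω → S i}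

theorem shannonEntropy_jointVar_lt_top (hX : ∀ i, Measurable (X i))
    (hH : ∀ i, shannonEntropy P (X i) < ⊤) (U : Finset V) :
    shannonEntropy P (jointVar X U) < ⊤ := by
  induction U using Finset.induction_on with
  | empty =>
    have : ∀ y, jointVar X ∅ ⁻¹' {y} = Set.univ := fun y =>
      Set.eq_univ_of_forall fun ω => funext fun i => absurd i.2 (Finset.notMem_empty _)
    simp [shannonEntropy, this]
  | insert i U hi ih =>
    refine shannonEntropy_lt_top_of_pair (hX i) (measurable_jointVar hX U)
      (measurable_jointVar hX _) (fun ω => ?_) (hH i) ih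
    simp only [jointVar_preimage_singleton_apply]
    ext ω'
    simp

theorem condMutualInfo_eq_zero (hX : ∀ i, Measurable (X i))
    (hH : ∀ i, shannonEntropy P (X i) < ⊤) {C D K : Finset V}
    (h : DiscreteCondIndep P (jointVar X C) (jointVar X D) (jointVar X K)) :
    condMutualInfo P X C D K = 0 := by
  have hfin := fun U => (shannonEntropy_jointVar_lt_top hX hH U).ne
  have key := h.shannonEntropy_add (measurable_jointVar hX K)
    (measurable_jointVar hX (C ∪ (D ∪ K))) (measurable_jointVar hX (C ∪ K))
    (measurable_jointVar hX (D ∪ K))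
    (fun ω => by simp only [jointVar_preimage_singleton_union, Set.inter_assoc])
    (jointVar_preimage_singleton_union X C K) (jointVar_preimage_singleton_union X D K)
  have := congrArg ENNReal.toReal key
  -- Finiteness is essential here, since `toReal` sends an infinite entropy to 0.
  rw [ENNReal.toReal_add (hfin _) (hfin _), ENNReal.toReal_add (hfin _) (hfin _)] at this
  simp only [condMutualInfo, condEntropy, jointEntropy]
  linarith

end JointVar

/-! ### Connected vertex sets -/

section Connected

variable {V : Type*} {G : SimpleGraph V}

/-- A connected set `R` of vertices stays connected after removing a suitable vertex outside of a
given connected proper subset. -/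
theorem exists_connected_induce_diff_singleton [Finite V] {R S : Set V}
    (hR : (G.induce R).Connected) (hS : (G.induce S).Connected) (hSR : S ⊂ R) :
    ∃ k ∈ R \ S, (G.induce (R \ {k})).Connected := by
  induction S using WellFoundedGT.induction with
  | ind S ih =>
    obtain ⟨⟨a₀, ha₀⟩⟩ := hS.nonempty
    obtain ⟨b₀, hb₀R, hb₀⟩ := Set.exists_of_ssubset hSR
    obtain ⟨p⟩ := hR.preconnected ⟨a₀, hSR.1 ha₀⟩ ⟨b₀, hb₀R⟩
    -- A path in `R` from `S` to a vertex outside has an edge leaving `S`; its endpoint can be added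
    -- to `S` without losing connectedness.
    obtain ⟨d, -, hd₁, hd₂⟩ := p.exists_boundary_dart {x | x.1 ∈ S} ha₀ hb₀
    have hb : d.snd.1 ∉ S := hd₂
    have hS' : (G.induce (S ∪ {d.snd.1})).Connected :=
      SimpleGraph.connected_induce_union hS.preconnected .of_subsingleton hd₁
        (Set.mem_singleton _) d.adj
    have hsub : S ∪ {d.snd.1} ⊆ R :=
      Set.union_subset hSR.1 (Set.singleton_subset_iff.2 d.snd.2)
    rcases hsub.eq_or_ssubset with heq | hss
    · refine ⟨d.snd.1, ⟨d.snd.2, hb⟩, ?_⟩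
      have hdiff : R \ {d.snd.1} = S :=
        (congrArg (· \ {d.snd.1}) heq.symm).trans
          (Set.union_sdiff_right.trans (Set.sdiff_singleton_eq_self hb))
      rwa [hdiff]
    · have hlt : S < S ∪ {d.snd.1} :=
        Set.ssubset_iff_exists.2 ⟨Set.subset_union_left, d.snd.1, Or.inr rfl, hb⟩
      obtain ⟨k, hk, hkR⟩ := ih _ hlt hS' hss
      exact ⟨k, ⟨hk.1, fun h => hk.2 (Or.inl h)⟩, hkR⟩

/-- Exactly one component excludes the empty graph, in agreement with the nonemptiness built into
`Connected`. -/
theorem numComponents_eq_one_iff {U : Finset V} {R : Set V} (h : R = {v | v ∉ U}) :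
    numComponents G U = 1 ↔ (G.induce R).Connected := by
  subst h
  rw [numComponents, Nat.card_eq_one_iff_unique]
  constructor
  · rintro ⟨hs, ⟨c⟩⟩
    obtain ⟨v, -⟩ := c.exists_rep
    have : Nonempty {v : V | v ∉ U} := ⟨v⟩
    exact ⟨fun a b => SimpleGraph.ConnectedComponent.exact (hs.elim _ _)⟩
  · intro h
    have := h.nonempty
    exact ⟨h.preconnected.subsingleton_connectedComponent, inferInstance⟩

variable [Fintype V] [DecidableEq V]

theorem mem_nonCutVertices_iff {U : Finset V} {k : V} :
    k ∈ nonCutVertices G U ↔ k ∉ U ∧ (G.induce ({v | v ∉ U} \ {k})).Connected := by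
  have : ({v | v ∉ U} \ {k} : Set V) = {v | v ∉ U ∪ {k}} := by
    ext v
    simp [and_comm]
  rw [nonCutVertices, Finset.mem_filter, numComponents_eq_one_iff this]
  simp

/-- A connected graph with at least two vertices has at least two vertices that are not cut
vertices. -/
theorem two_le_card_nonCutVertices {U : Finset V} (hU : (G.induce {v | v ∉ U}).Connected)
    (hcard : U.card + 2 ≤ Fintype.card V) : 2 ≤ (nonCutVertices G U).card := by
  -- Growing from `{a}` gives a non-cut vertex other than `a`; a second use, with that vertex in
  -- place of `a`, gives another.
  have key : ∀ a, a ∉ U → ∃ k ∈ nonCutVertices G U, k ≠ a := by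
    intro a ha
    have hss : ({a} : Set V) ⊂ {v | v ∉ U} := by
      have hlt : (insert a U).card < Fintype.card V := by
        rw [Finset.card_insert_of_notMem ha]
        omega
      have hne := (Finset.card_lt_iff_ne_univ _).1 hlt
      simp only [ne_eq, Finset.eq_univ_iff_forall, not_forall, Finset.mem_insert, not_or] at hne
      obtain ⟨b, hba, hbU⟩ := hne
      exact Set.ssubset_iff_exists.2 ⟨Set.singleton_subset_iff.2 ha, b, hbU, hba⟩
    obtain ⟨k, hk, hkc⟩ := exists_connected_induce_diff_singleton hU
      (S := {a}) ((SimpleGraph.connected_iff _).2 ⟨.of_subsingleton, ⟨⟨a, rfl⟩⟩⟩) hss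
    exact ⟨k, mem_nonCutVertices_iff.2 ⟨hk.1, hkc⟩, hk.2⟩
  obtain ⟨⟨a, ha⟩⟩ := hU.nonempty
  obtain ⟨k, hk, -⟩ := key a ha
  obtain ⟨l, hl, hlk⟩ := key k (mem_nonCutVertices_iff.1 hk).1
  exact Finset.one_lt_card.2 ⟨l, hl, k, hk, hlk⟩

/-- A connected subset of `G \ U` that contains all the vertices that are not cut vertices of
`G \ U` is everything. -/
theorem eq_of_nonCutVertices_subset {U : Finset V} {R : Set V}
    (hU : (G.induce {v | v ∉ U}).Connected) (hR : (G.induce R).Connected)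
    (hRU : R ⊆ {v | v ∉ U}) (hB : ∀ k ∈ nonCutVertices G U, k ∈ R) : R = {v | v ∉ U} := by
  by_contra hne
  obtain ⟨k, hk, hkc⟩ := exists_connected_induce_diff_singleton hU hR (hRU.ssubset_of_ne hne)
  exact hk.2 (hB k (mem_nonCutVertices_iff.2 ⟨hk.1, hkc⟩))

end Connected

/-- An atom is a single point, whose indices are those not in `U_A`. -/
theorem IsInfoAtom.exists_eq_singleton {V : Type*} [Fintype V]
    {A : Set (InfoSpace V)} (hA : IsInfoAtom A) :
    ∃ W : InfoSpace V, A = {W} ∧ ∀ i, i ∈ W.idx ↔ i ∉ complementedIndices A := by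
  obtain ⟨⟨W, hW⟩, Y, hY, rfl⟩ := hA
  have hiff : ∀ Z ∈ ⋂ i, Y i, ∀ i, i ∈ Z.idx ↔ i ∉ complementedIndices (⋂ i, Y i) := by
    intro Z hZ i
    rw [mem_complementedIndices hY ⟨W, hW⟩]
    have hZi : Z ∈ Y i := Set.mem_iInter.1 hZ i
    rcases hY i with h | h
    · rw [h] at hZi ⊢
      exact ⟨fun hi h' => (h' ▸ hZi : Z ∈ (setVar i)ᶜ) hi, fun _ => hZi⟩
    · rw [h] at hZi ⊢
      exact ⟨fun hi => absurd hi hZi, fun h' => absurd rfl h'⟩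
  refine ⟨W, Set.eq_singleton_iff_unique_mem.2 ⟨hW, fun Z hZ => ?_⟩, hiff W hW⟩
  ext i
  rw [hiff Z hZ, hiff W hW]

/-! ### Atoms on which the I-Measure vanishes -/

section Vanishing

variable {V : Type*} [Fintype V] [DecidableEq V] {Ω : Type*} [MeasurableSpace Ω] {P : Measure Ω}
  {S : V → Type*} {X : ∀ i, Ω → S i}

/-- If `I(X_C ; X_D | X_K) = 0` for all `C ⊆ V₁` and `D ⊆ V₂`, the I-Measure vanishes on the atoms
inside `(X̃_{V₁} ∩ X̃_{V₂}) - X̃_K` that lie in no set variable outside of `V₁ ∪ V₂`. -/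
theorem IsIMeasure.singleton_eq_zero {ν : SignedMeasure (InfoSpace V)} (hν : IsIMeasure P X ν)
    {V₁ V₂ K : Finset V} (hcov : K ∪ V₁ ∪ V₂ = Finset.univ)
    (hI : ∀ C ⊆ V₁, ∀ D ⊆ V₂, condMutualInfo P X C D K = 0) {W : InfoSpace V}
    (h₁ : W ∈ setVarUnion V₁) (h₂ : W ∈ setVarUnion V₂) (hK : W ∉ setVarUnion K) :
    ν {W} = 0 := by
  classical
  let E : Finset V → Finset V → Set (InfoSpace V) := fun C D =>
    (setVarUnion C ∩ setVarUnion D) \ setVarUnion K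
  have hE : ∀ C ⊆ V₁, ∀ D ⊆ V₂, ∑ Z : InfoSpace V, (if Z ∈ E C D then ν {Z} else 0) = 0 := by
    intro C hC D hD
    rw [← InfoSpace.signedMeasure_eq_sum, hν.cond_mutual_info, hI C hC D hD]
  -- The inversion lemma is applied to `ν` restricted to `E V₁ V₂`.
  have hd : (fun Z => if Z ∈ E V₁ V₂ then ν {Z} else 0) = 0 := by
    refine InfoSpace.eq_zero_of_sum_eq_zero _ fun T => ?_
    -- Inclusion–exclusion: a point of `E V₁ V₂` avoids `K`, so if it meets `T` it does so inside
    -- `V₁` or inside `V₂`.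
    have hT : ∀ Z : InfoSpace V,
        (if ∃ i ∈ T, i ∈ Z.idx then (if Z ∈ E V₁ V₂ then ν {Z} else 0) else 0) =
          (if Z ∈ E (T ∩ V₁) V₂ then ν {Z} else 0) + (if Z ∈ E V₁ (T ∩ V₂) then ν {Z} else 0) -
            (if Z ∈ E (T ∩ V₁) (T ∩ V₂) then ν {Z} else 0) := by
      intro Z
      have hTV : (∃ i ∈ T, i ∈ Z.idx) → Z ∉ setVarUnion K →
          Z ∈ setVarUnion (T ∩ V₁) ∨ Z ∈ setVarUnion (T ∩ V₂) := by
        rintro ⟨i, hiT, hiZ⟩ hZK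
        have hi : i ∈ K ∪ V₁ ∪ V₂ := hcov ▸ Finset.mem_univ i
        simp only [mem_setVarUnion, Finset.mem_inter, Finset.mem_union] at hi hZK ⊢
        grind
      have hT₁ : Z ∈ setVarUnion (T ∩ V₁) → (∃ i ∈ T, i ∈ Z.idx) ∧ Z ∈ setVarUnion V₁ := by
        simp only [mem_setVarUnion, Finset.mem_inter]
        grind
      have hT₂ : Z ∈ setVarUnion (T ∩ V₂) → (∃ i ∈ T, i ∈ Z.idx) ∧ Z ∈ setVarUnion V₂ := by
        simp only [mem_setVarUnion, Finset.mem_inter]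
        grind
      simp only [E, Set.mem_sdiff, Set.mem_inter_iff]
      by_cases a : ∃ i ∈ T, i ∈ Z.idx <;> by_cases b : Z ∈ setVarUnion K <;>
        by_cases c₁ : Z ∈ setVarUnion (T ∩ V₁) <;> by_cases c₂ : Z ∈ setVarUnion (T ∩ V₂) <;>
        by_cases e₁ : Z ∈ setVarUnion V₁ <;> by_cases e₂ : Z ∈ setVarUnion V₂ <;>
        simp_all
    rw [Finset.sum_congr rfl fun Z _ => hT Z, Finset.sum_sub_distrib, Finset.sum_add_distrib,
      hE _ Finset.inter_subset_right _ subset_rfl, hE _ subset_rfl _ Finset.inter_subset_right,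
      hE _ Finset.inter_subset_right _ Finset.inter_subset_right]
    simp
  have := congrFun hd W
  rwa [Pi.zero_apply, if_pos (show W ∈ E V₁ V₂ from ⟨⟨h₁, h₂⟩, hK⟩)] at this

/-- The I-Measure of random variables that form a Markov graph `G` vanishes on the atoms whose
set of uncomplemented indices is not connected in `G`. -/
theorem iMeasure_singleton_eq_zero_of_not_connected [IsProbabilityMeasure P]
    [∀ i, Countable (S i)] [∀ i, MeasurableSpace (S i)] [∀ i, MeasurableSingletonClass (S i)]
    (hX : ∀ i, Measurable (X i)) (hH : ∀ i, shannonEntropy P (X i) < ⊤)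
    {G : SimpleGraph V} (hG : FormMarkovGraph P X G) {W : InfoSpace V}
    (hW : ¬ (G.induce {v | v ∈ W.idx}).Connected) : iMeasure P X {W} = 0 := by
  classical
  obtain ⟨a, ha⟩ := W.idx_nonempty
  have hU : ∀ v, v ∉ W.idxᶜ ↔ v ∈ W.idx := fun v => by simp
  let a' : {v | v ∉ W.idxᶜ} := ⟨a, (hU a).2 ha⟩
  -- The component of `a` in the graph induced on `W.idx`; the rest of `W.idx` is cut off from it.
  let V₁ : Finset V := {v | ∃ h : v ∉ W.idxᶜ, (removeVertices G W.idxᶜ).Reachable a' ⟨v, h⟩}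
  let V₂ : Finset V := W.idx \ V₁
  have hV₁ : ∀ v, v ∈ V₁ ↔ ∃ h : v ∉ W.idxᶜ, (removeVertices G W.idxᶜ).Reachable a' ⟨v, h⟩ :=
    fun v => by simp [V₁]
  have hsub : V₁ ⊆ W.idx := fun v hv => (hU v).1 ((hV₁ v).1 hv).1
  have hcov : W.idxᶜ ∪ V₁ ∪ V₂ = Finset.univ := by
    rw [Finset.union_assoc, Finset.union_sdiff_of_subset hsub, Finset.union_comm,
      Finset.union_compl]
  have hind := hG W.idxᶜ V₁ V₂ (disjoint_compl_left.mono_right hsub)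
    (disjoint_compl_left.mono_right Finset.sdiff_subset) Finset.disjoint_sdiff hcov (by
      intro x y hx hy hxy
      obtain ⟨_, hax⟩ := (hV₁ x).1 hx
      exact (Finset.mem_sdiff.1 hy).2 ((hV₁ y).2 ⟨y.2, hax.trans hxy⟩))
  have hne : ∃ b ∈ W.idx, b ∉ V₁ := by
    by_contra! hall
    refine hW ?_
    have hset : {v | v ∈ W.idx} = {v | v ∉ W.idxᶜ} := by
      ext v
      exact (hU v).symm
    rw [hset, SimpleGraph.connected_iff_exists_forall_reachable]
    exact ⟨a', fun w => ((hV₁ w).1 (hall w ((hU w).1 w.2))).2⟩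
  obtain ⟨b, hbW, hb⟩ := hne
  refine (iMeasure_spec P X).singleton_eq_zero hcov
    (fun C hC D hD => condMutualInfo_eq_zero hX hH (hind.jointVar_subset hX hC hD))
    ((mem_setVarUnion _ _).2 ⟨a, (hV₁ a).2 ⟨a'.2, .rfl⟩, ha⟩)
    ((mem_setVarUnion _ _).2 ⟨b, Finset.mem_sdiff.2 ⟨hbW, hb⟩, hbW⟩) ?_
  rw [mem_setVarUnion]
  rintro ⟨i, hi, hiW⟩
  exact Finset.mem_compl.1 hi hiW

end Vanishing

theorem mainTheorem5 {V : Type*} [Fintype V] [DecidableEq V]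
    {Ω : Type*} [MeasurableSpace Ω] (P : Measure Ω) [IsProbabilityMeasure P]
    {S : V → Type*} [∀ i, Countable (S i)] [∀ i, MeasurableSpace (S i)]
    [∀ i, MeasurableSingletonClass (S i)]
    (X : ∀ i, Ω → S i) (hX : ∀ i, Measurable (X i))
    (hH : ∀ i, shannonEntropy P (X i) < ⊤)
    (G : SimpleGraph V) (hG : FormMarkovGraph P X G)
    (A : Set (InfoSpace V)) (hA : IsTypeIAtom G A)
    (hcard : (complementedIndices A).card + 2 ≤ Fintype.card V) :
    iMeasure P X A =
        iMeasure P X ((⋂ k ∈ nonCutVertices G (complementedIndices A), setVar k) \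
          setVarUnion (complementedIndices A)) ∧
      2 ≤ (nonCutVertices G (complementedIndices A)).card := by
  classical
  obtain ⟨hatom, hs⟩ := hA
  have hU := (numComponents_eq_one_iff rfl).1 hs
  refine ⟨?_, two_le_card_nonCutVertices hU hcard⟩
  obtain ⟨W, hAW, hW⟩ := hatom.exists_eq_singleton
  have hidx : {v | v ∈ W.idx} = {v | v ∉ complementedIndices A} := Set.ext hW
  set U := complementedIndices A
  -- Sum over the points of the right-hand set; only the point `W` of `A` survives.
  rw [InfoSpace.signedMeasure_eq_sum (iMeasure P X) ((⋂ k ∈ nonCutVertices G U, setVar k) \ _),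
    Finset.sum_eq_single W, if_pos, hAW]
  · refine ⟨Set.mem_iInter₂.2 fun k hk => (hW k).2 (mem_nonCutVertices_iff.1 hk).1, ?_⟩
    rw [mem_setVarUnion]
    rintro ⟨i, hi, hiW⟩
    exact (hW i).1 hiW hi
  · intro Z _ hne
    split_ifs with hZ
    -- If `Z.idx` were connected, containing `B` would force it to be all of `V \ U`, so that `Z =
    -- W`.
    · refine iMeasure_singleton_eq_zero_of_not_connected hX hH hG fun hZc => hne ?_
      have heq := eq_of_nonCutVertices_subset hU hZc
        (fun v hv hvU => hZ.2 ((mem_setVarUnion _ _).2 ⟨v, hvU, hv⟩))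
        (fun k hk => Set.mem_iInter₂.1 hZ.1 k hk)
      ext i
      exact Set.ext_iff.1 (heq.trans hidx.symm) i
    · rfl
  · exact fun h => absurd (Finset.mem_univ W) h
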